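/- A topological Schottky set is a proper compact subset $\mathcal S\subset S^2$ such that, writing $\{D_i\}_{i\in I}$ for the set of connected components of $S^2\setminus\mathcal S$: (S1) $I$ is countable and non-empty; (S2) each $D_i$ is a Jordan domain, that is, $\overline{D_i}=D_i\cup\partial D_i$ is homeomorphic to the closed unit disc by a homeomorphism carrying $D_i$ onto the open unit disc; (S3) $\overline{D_i}\cap\overline{D_j}$ has at most one point whenever $i\ne j$; (S4) $\overline{D_i}\cap\overline{D_j}\cap\overline{D_k}=\emptyset$ for any three distinct indices $i,j,k$; (S5) for every open cover $\mathcal U$ of $S^2$, for all but finitely many $i\in I$ there is a $U\in\mathcal U$ with $D_i\subset U$. Proposition. (1) Let $\mathcal S$ be a topological Schottky set with complementary components $\{D_i\}_{i\in I}$. A subset $C\subset S^2$ is a non-separating embedded circle of $\mathcal S$ (that is, $C\subset\mathcal S$, $C$ is homeomorphic to the unit circle, and $\mathcal S\setminus C$ is connected) if and only if $C=C_i:=\overline{D_i}\cap\mathcal S$ for some $i\in I$. (2) Every homeomorphism $h:\mathcal S_1\to\mathcal S_2$ between two topological Schottky sets is the restriction of a homeomorphism $H:S^2\to S^2$. -/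

import Mathlib

open Set Topology

/-- The 2-sphere `S²`, the unit sphere of Euclidean 3-space with its subspace topology. -/
abbrev S2 : Type := Metric.sphere (0 : EuclideanSpace ℝ (Fin 3)) 1

/-- The set `{D_i}` of connected components of `S² ∖ S`. -/
def complComponents (S : Set S2) : Set (Set S2) :=
  {D | ∃ x ∈ Sᶜ, D = connectedComponentIn Sᶜ x}

/-- `D` is a Jordan domain: its closure `D ∪ ∂D` is a closed disc, whose open disc is `D`
(so that its boundary circle is `∂D`). -/
def IsJordanDomain (D : Set S2) : Prop :=
  ∃ f : Metric.closedBall (0 : ℂ) 1 → S2,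
    IsEmbedding f ∧ range f = closure D ∧ f '' {z | ‖(z : ℂ)‖ < 1} = D

/-- Topological Schottky sets in `S²`. -/
structure IsTopologicalSchottkySet (S : Set S2) : Prop where
  isCompact : IsCompact S
  proper : S ≠ univ
  countable : (complComponents S).Countable
  nonempty : (complComponents S).Nonempty
  jordan : ∀ D ∈ complComponents S, IsJordanDomain D
  pair : ∀ D ∈ complComponents S, ∀ D' ∈ complComponents S, D ≠ D' →
    (closure D ∩ closure D').Subsingleton
  triple : ∀ D ∈ complComponents S, ∀ D' ∈ complComponents S, ∀ D'' ∈ complComponents S,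
    D ≠ D' → D ≠ D'' → D' ≠ D'' → closure D ∩ closure D' ∩ closure D'' = ∅
  cover : ∀ 𝒰 : Set (Set S2), (∀ U ∈ 𝒰, IsOpen U) → ⋃₀ 𝒰 = univ →
    {D ∈ complComponents S | ¬ ∃ U ∈ 𝒰, D ⊆ U}.Finite

/-- `C` is an embedded circle of `S`. -/
def IsEmbeddedCircleIn (S C : Set S2) : Prop :=
  C ⊆ S ∧ ∃ γ : Circle → S2, IsEmbedding γ ∧ range γ = C

/-- `C` does not separate `S`. -/
def IsNonseparatingIn (S C : Set S2) : Prop :=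
  IsConnected (S \ C)

/-- The circle `C_i = closure D_i ∩ S` belonging to the component `D = D_i` of `S² ∖ S`. -/
def boundaryCircle (S D : Set S2) : Set S2 :=
  closure D ∩ S

/-! Planar input: a Jordan curve separates the sphere, a closed disc does not. Both come from
lifting through the covering `Complex.exp`: the identity of the circle has no continuous logarithm,
and a separation behaving otherwise would build one (`not_isPreconnected_compl_of_circle_sphere`,
`isPreconnected_compl_disc_sphere`).

Boundary circles do not separate (`isPreconnected_diff_boundaryCircle`): the complement of `closure
D` is connected. Given a splitting of `S \ C`, every other boundary circle minus `C` is connected,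
as it loses at most one point, so it lies on one side; filling in its disc on that side would split
the complement of `closure D`. The enlarged sides are open because the components form a null family
(`exists_finite_nhds`).

Conversely (`exists_eq_boundaryCircle`), if `C` does not separate `S`, then `S \ C` lies in one
component of the complement of `C`. By Jordan separation there is another component; it misses `S`,
so it is a component `D` of `Sᶜ`. Its boundary circle lies in `C`, and a circle inside a circle is
all of it.

Non-separating circles are topologically intrinsic, so a homeomorphism matches the boundary circles
of the two sets. It is coned off over each disc, and the glued map is continuous because both
families of discs are null. -/

/-! ### Circle-valued and planar preliminaries -/

/-- One-dimensional Borsuk–Ulam: `k w - k (-w)` is odd, so it vanishes somewhere. -/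
theorem Circle.not_injective_of_continuous_real {k : Circle → ℝ} (hk : Continuous k) :
    ¬ Function.Injective k := by
  intro hinj
  have hc : Continuous fun w : Circle => k w - k (-w) := by fun_prop
  have hne : ∀ w : Circle, w ≠ -w := fun w h => by
    have h2 : (w : ℂ) = -(w : ℂ) := by simpa using congrArg (Subtype.val) h
    exact w.coe_ne_zero (self_eq_neg.mp h2)
  obtain ⟨w, hw⟩ : ∃ w, k w - k (-w) = 0 := by
    rcases le_total (k 1 - k (-1)) 0 with h | h
    · exact mem_range_of_exists_le_of_exists_ge hc ⟨1, h⟩ ⟨-1, by rw [neg_neg]; linarith⟩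
    · exact mem_range_of_exists_le_of_exists_ge hc ⟨-1, by rw [neg_neg]; linarith⟩ ⟨1, h⟩
  exact hne w (hinj (by linarith))

/-- Such a logarithm is purely imaginary, so its imaginary part would be injective. -/
theorem Circle.not_exists_continuous_log {g : Circle → ℂ} (hg : Continuous g) :
    ¬ ∀ w : Circle, Complex.exp (g w) = w := by
  intro h
  refine Circle.not_injective_of_continuous_real (Complex.continuous_im.comp hg) ?_
  have hre : ∀ w, (g w).re = 0 := fun w => by
    have h1 := Complex.norm_exp (g w)
    rw [h w, Circle.norm_coe] at h1
    exact (Real.exp_eq_one_iff _).mp h1.symm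
  intro a b hab
  have : g a = g b := Complex.ext (by rw [hre, hre]) hab
  exact Circle.ext (by rw [← h a, ← h b, this])

/-- If `w₀` were missed, `-(η w / w₀)` would avoid `-1`, where `arg` jumps, and its argument would
be a continuous injection into the reals. -/
theorem Circle.surjective_of_continuous_injective {η : Circle → Circle} (hη : Continuous η)
    (hinj : Function.Injective η) : Function.Surjective η := by
  by_contra hs
  obtain ⟨w₀, hw₀⟩ : ∃ w₀, ∀ w, η w ≠ w₀ := by
    simpa [Function.Surjective] using hs
  have hmem : ∀ w, ((-(η w / w₀) : Circle) : ℂ) ∈ Complex.slitPlane := by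
    intro w
    rw [Complex.mem_slitPlane_iff_arg]
    refine ⟨fun h => hw₀ w ?_, Circle.coe_ne_zero _⟩
    have h1 : (-(η w / w₀) : Circle) = -1 := by
      refine Circle.injective_arg (h.trans ?_)
      simp
    have := neg_injective h1
    exact div_eq_one.mp this
  refine Circle.not_injective_of_continuous_real
    (k := fun w => Complex.arg ((-(η w / w₀) : Circle) : ℂ)) ?_ ?_
  · exact continuous_iff_continuousAt.mpr fun w =>
      (Complex.continuousAt_arg (hmem w)).comp
        (f := fun w => ((-(η w / w₀) : Circle) : ℂ)) (by fun_prop)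
  · intro a b hab
    have := neg_injective (Circle.injective_arg hab)
    exact hinj (div_left_injective this)

theorem range_eq_of_range_subset_of_isEmbedding_circle {X : Type*} [TopologicalSpace X]
    {γ₁ γ : Circle → X} (h₁ : IsEmbedding γ₁) (h : IsEmbedding γ)
    (hsub : range γ₁ ⊆ range γ) : range γ₁ = range γ := by
  choose η hη using fun w => hsub (mem_range_self w)
  have hcomp : γ ∘ η = γ₁ := funext hη
  have hc : Continuous η := by rw [h.continuous_iff, hcomp]; exact h₁.continuous
  have hi : Function.Injective η := by
    refine Function.Injective.of_comp (f := γ) ?_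
    rw [hcomp]; exact h₁.injective
  rw [← hcomp, range_comp, (Circle.surjective_of_continuous_injective hc hi).range_eq, image_univ]

theorem exists_continuous_log_of_continuous {F : ℂ → ℂ} (hF : Continuous F) (h0 : ∀ z, F z ≠ 0) :
    ∃ G : ℂ → ℂ, Continuous G ∧ ∀ z, Complex.exp (G z) = F z := by
  obtain ⟨G, ⟨-, hG⟩, -⟩ := Complex.isCoveringMap_exp.existsUnique_continuousMap_lifts
    (⟨fun z => ⟨F z, h0 z⟩, hF.subtype_mk _⟩ : C(ℂ, {z : ℂ // z ≠ 0})) (a₀ := 0)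
    (e₀ := Complex.log (F 0)) (Subtype.ext (Complex.exp_log (h0 0)))
  exact ⟨G, G.continuous, fun z => congrArg Subtype.val (congrFun hG z)⟩

/-- Off a path from `p` to `q`, the function `(z - p) / (z - q)` has a continuous logarithm. -/
theorem exists_log_off_path (α : C(unitInterval, ℂ)) :
    ∃ g : ℂ → ℂ, ContinuousOn g (range α)ᶜ ∧
      ∀ z ∉ range α, Complex.exp (g z) = (z - α 0) / (z - α 1) := by
  classical
  have hne : ∀ (z : ↥(range α)ᶜ) t, (z : ℂ) - α t ≠ 0 := fun z t h =>
    z.2 ⟨t, (sub_eq_zero.mp h).symm⟩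
  -- Sliding the numerator's base point along the path from `α 1` to `α 0` deforms the constant `1`,
  -- with logarithm `0`, into the desired quotient.
  let H : C(unitInterval × ↥(range α)ᶜ, {z : ℂ // z ≠ 0}) :=
    ⟨fun x => ⟨((x.2 : ℂ) - α (unitInterval.symm x.1)) / (x.2 - α 1),
        div_ne_zero (hne _ _) (hne _ _)⟩, by
      refine Continuous.subtype_mk (Continuous.div (by fun_prop) (by fun_prop) ?_) _
      exact fun x => hne _ _⟩
  have H0 : ∀ a, H (0, a) = (⟨_, Complex.exp_ne_zero ((0 : C(↥(range α)ᶜ, ℂ)) a)⟩ :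
      {z : ℂ // z ≠ 0}) := by
    intro a
    apply Subtype.ext
    simp [H, div_self (hne a 1)]
  let G := Complex.isCoveringMap_exp.liftHomotopy H 0 H0
  have hG := Complex.isCoveringMap_exp.liftHomotopy_lifts H 0 H0
  refine ⟨fun z => if hz : z ∈ (range α)ᶜ then G (1, ⟨z, hz⟩) else 0, ?_, ?_⟩
  · rw [continuousOn_iff_continuous_domRestrict]
    have : (range α)ᶜ.domRestrict (fun z => if hz : z ∈ (range α)ᶜ then G (1, ⟨z, hz⟩) else 0)
        = fun z => G (1, z) := by
      ext z
      simp only [domRestrict_apply, dif_pos z.2]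
    rw [this]
    fun_prop
  · intro z hz
    have h1 := congrArg Subtype.val (congrFun hG (1, ⟨z, hz⟩))
    beta_reduce
    rw [dif_pos (show z ∈ (range α)ᶜ from hz)]
    simpa [H, G] using h1

/-- The quotient winds once around `0` along the circle `p + u * w`, which encloses `p` but not `q`:
there `z - q = 2 * u * (1 + w / 2)`, and `1 + w / 2` has a principal logarithm, so a logarithm of
the quotient would yield one of `w`. -/
theorem not_exists_log_div {p q : ℂ} (hpq : p ≠ q) {g : ℂ → ℂ} (hg : ContinuousOn g {p, q}ᶜ) :
    ¬ ∀ z ∈ ({p, q} : Set ℂ)ᶜ, Complex.exp (g z) = (z - p) / (z - q) := by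
  intro h
  set u : ℂ := (p - q) / 2 with hu
  have hu0 : u ≠ 0 := div_ne_zero (sub_ne_zero.mpr hpq) two_ne_zero
  have hq : q = p - 2 * u := by rw [hu]; ring
  have hmem : ∀ w : Circle, p + u * w ∈ ({p, q} : Set ℂ)ᶜ := by
    intro w hw
    rcases hw with hw | hw
    · simp [hu0] at hw
    · rw [mem_singleton_iff, hq] at hw
      have h1 : u * (w + 2) = 0 := by linear_combination hw
      have h2 : (w : ℂ) = -2 := by
        rcases mul_eq_zero.mp h1 with h | h
        · exact absurd h hu0
        · linear_combination h
      have := congrArg norm h2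
      rw [Circle.norm_coe] at this
      norm_num at this
  have hslit : ∀ w : Circle, 1 + (w : ℂ) / 2 ∈ Complex.slitPlane := fun w =>
    Complex.mem_slitPlane_of_norm_lt_one (by rw [norm_div, Circle.norm_coe]; norm_num)
  refine Circle.not_exists_continuous_log
    (g := fun w => g (p + u * w) + Complex.log (1 + (w : ℂ) / 2) + Complex.log 2) ?_ ?_
  · refine ((hg.comp_continuous (by fun_prop) hmem).add ?_).add continuous_const
    exact Continuous.clog (by fun_prop) hslit
  · intro w
    have h3 := Complex.slitPlane_ne_zero (hslit w)
    rw [Complex.exp_add, Complex.exp_add, h _ (hmem w), Complex.exp_log h3,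
      Complex.exp_log two_ne_zero, hq]
    have h4 : p + u * w - (p - 2 * u) = u * (2 * (1 + (w : ℂ) / 2)) := by ring
    have h5 : p + u * w - p = u * w := by ring
    rw [h4, h5, mul_div_mul_left _ _ hu0, mul_assoc, mul_comm _ (2 : ℂ),
      div_mul_cancel₀ _ (mul_ne_zero two_ne_zero h3)]

/-! ### Separation in the plane -/

theorem eqOn_add_const_of_exp_eq {s : Set ℂ} (hs : IsPreconnected s) {g₁ g₂ : ℂ → ℂ}
    (h₁ : ContinuousOn g₁ s) (h₂ : ContinuousOn g₂ s)
    (he : ∀ z ∈ s, Complex.exp (g₁ z) = Complex.exp (g₂ z)) :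
    ∃ c, Complex.exp c = 1 ∧ ∀ z ∈ s, g₁ z = g₂ z + c := by
  rcases s.eq_empty_or_nonempty with rfl | ⟨z₀, hz₀⟩
  · exact ⟨0, Complex.exp_zero, by simp⟩
  have hc : Complex.exp (g₁ z₀ - g₂ z₀) = 1 := by
    rw [Complex.exp_sub, he z₀ hz₀, div_self (Complex.exp_ne_zero _)]
  refine ⟨g₁ z₀ - g₂ z₀, hc, ?_⟩
  refine Complex.isCoveringMap_exp.eqOn_of_comp_eqOn (g₂ := fun z => g₂ z + (g₁ z₀ - g₂ z₀)) hs h₁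
    (h₂.add continuousOn_const) (fun z hz => Subtype.ext ?_) hz₀ (by ring)
  simp [Complex.exp_add, hc, he z hz]

/-- The complement of a union of two arcs with common endpoints, and meeting only there, is not
connected. -/
theorem not_isPreconnected_compl_union_arcs (α β : C(unitInterval, ℂ)) (h0 : α 0 = β 0)
    (h1 : α 1 = β 1) (h01 : α 0 ≠ α 1) (hint : range α ∩ range β ⊆ {α 0, α 1}) :
    ¬ IsPreconnected (range α ∪ range β)ᶜ := by
  classical
  intro hpre
  obtain ⟨f, hf, hfe⟩ := exists_log_off_path α
  obtain ⟨g, hg, hge⟩ := exists_log_off_path β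
  rw [← h0, ← h1] at hge
  have hα : IsOpen (range α)ᶜ := (isCompact_range α.continuous).isClosed.isOpen_compl
  have hβ : IsOpen (range β)ᶜ := (isCompact_range β.continuous).isClosed.isOpen_compl
  obtain ⟨c, hc, hfg⟩ := eqOn_add_const_of_exp_eq hpre
    (hf.mono (compl_subset_compl.mpr subset_union_left))
    (hg.mono (compl_subset_compl.mpr subset_union_right)) (fun z hz => by
      rw [mem_compl_iff, mem_union, not_or] at hz
      rw [hfe z hz.1, hge z hz.2])
  -- If the complement of the union is connected, the two logarithms differ there by a constant `c`,
  -- so they glue to a logarithm on the plane minus both endpoints.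
  let F : ℂ → ℂ := fun z => if z ∈ range α then g z + c else f z
  have hF1 : ∀ z ∈ (range α)ᶜ, F z = f z := fun z hz => if_neg hz
  have hF2 : ∀ z ∈ (range β)ᶜ, F z = g z + c := fun z hz => by
    by_cases h : z ∈ range α
    · exact if_pos h
    · rw [hF1 z h, hfg z (by simp only [mem_compl_iff, mem_union, not_or]; exact ⟨h, hz⟩)]
  have hcov : ∀ z ∈ ({α 0, α 1} : Set ℂ)ᶜ, z ∈ (range α)ᶜ ∨ z ∈ (range β)ᶜ := by
    intro z hz
    by_contra! h
    exact hz (hint ⟨not_not.mp h.1, not_not.mp h.2⟩)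
  refine not_exists_log_div h01 (g := F) ?_ ?_
  · intro z hz
    refine ContinuousAt.continuousWithinAt ?_
    rcases hcov z hz with h | h
    · exact (hf.continuousAt (hα.mem_nhds h)).congr
        (Filter.mem_of_superset (hα.mem_nhds h) fun w hw => (hF1 w hw).symm)
    · exact ((hg.continuousAt (hβ.mem_nhds h)).add continuousAt_const).congr
        (Filter.mem_of_superset (hβ.mem_nhds h) fun w hw => (hF2 w hw).symm)
  · intro z hz
    rcases hcov z hz with h | h
    · rw [hF1 z h, hfe z h]
    · rw [hF2 z h, Complex.exp_add, hc, mul_one, hge z h]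

/-- A Jordan curve separates the plane. -/
theorem not_isPreconnected_compl_range_circle {γ : Circle → ℂ} (hγ : Continuous γ)
    (hinj : Function.Injective γ) : ¬ IsPreconnected (range γ)ᶜ := by
  -- The images of the upper and lower half circles, both run from `1` to `-1`.
  let α : C(unitInterval, ℂ) := ⟨fun t => γ (Circle.exp (Real.pi * t)), by fun_prop⟩
  let β : C(unitInterval, ℂ) := ⟨fun t => γ (Circle.exp (-(Real.pi * t))), by fun_prop⟩
  have hpi := Real.pi_pos
  have hunion : range α ∪ range β = range γ := by
    apply Subset.antisymm
    · rintro _ (⟨t, rfl⟩ | ⟨t, rfl⟩) <;> exact mem_range_self _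
    · rintro _ ⟨w, rfl⟩
      have hw : Circle.exp (Complex.arg w) = w := Circle.exp_arg w
      have h1 := Complex.arg_le_pi w
      have h2 := Complex.neg_pi_lt_arg w
      rcases le_total 0 (Complex.arg w) with h | h
      · refine Or.inl ⟨⟨Complex.arg w / Real.pi, by positivity, by rw [div_le_one hpi]; exact h1⟩, ?_⟩
        change γ (Circle.exp (Real.pi * (Complex.arg w / Real.pi))) = γ w
        rw [mul_div_cancel₀ _ hpi.ne', hw]
      · refine Or.inr ⟨⟨-Complex.arg w / Real.pi, div_nonneg (by linarith) hpi.le,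
          by rw [div_le_one hpi]; linarith⟩, ?_⟩
        change γ (Circle.exp (-(Real.pi * (-Complex.arg w / Real.pi)))) = γ w
        rw [mul_div_cancel₀ _ hpi.ne', neg_neg, hw]
  have hne : Circle.exp Real.pi ≠ 1 := by
    intro h
    have := congrArg Subtype.val h
    simp at this
    norm_num [Complex.ext_iff] at this
  have h0 : α 0 = β 0 := by simp [α, β]
  have h1 : α 1 = β 1 := by
    simp only [α, β, ContinuousMap.coe_mk, Icc.coe_one, mul_one]
    congr 1
    rw [Circle.exp_neg]
    ext
    simp
  rw [← hunion]
  refine not_isPreconnected_compl_union_arcs α β h0 h1 ?_ ?_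
  · intro h
    have := hinj h
    simp only [Icc.coe_zero, Icc.coe_one, mul_one, mul_zero,
      Circle.exp_zero] at this
    exact hne this.symm
  · rintro _ ⟨⟨t, rfl⟩, ⟨s, hs⟩⟩
    have h2 : Circle.exp (-(Real.pi * s)) = Circle.exp (Real.pi * t) := hinj hs
    obtain ⟨m, hm⟩ := Circle.exp_eq_exp.mp h2
    have ht := t.2.1
    have ht' := t.2.2
    have hs0 := s.2.1
    have hs1 := s.2.2
    -- With `s` and `t` in `[0, 1]` only `m = 0` and `m = -1` survive, which are the two endpoints.
    have h3 : -(s : ℝ) = t + 2 * m := by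
      have : Real.pi * (-(s : ℝ)) = Real.pi * (t + 2 * m) := by linear_combination hm
      exact mul_left_cancel₀ hpi.ne' this
    have hm0 : m ≤ 0 := by
      have : (m : ℝ) < 1 := by linarith
      exact Int.lt_add_one_iff.mp (by exact_mod_cast this)
    have hm1 : -1 ≤ m := by
      have : (-1 : ℝ) ≤ m := by linarith
      exact_mod_cast this
    have hm' : m = 0 ∨ m = -1 := by omega
    rcases hm' with rfl | rfl
    · left
      have : t = 0 := Subtype.ext (by push_cast at h3; show (t : ℝ) = 0; linarith)
      rw [this]
    · right
      have : t = 1 := Subtype.ext (by push_cast at h3; show (t : ℝ) = 1; linarith)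
      rw [this]; rfl

/-- If `z - a` has a continuous logarithm on `K`, then `a` is not in a bounded open set whose
boundary lies in `K`. -/
theorem not_exists_log_of_isBounded {K A : Set ℂ} (hK : IsClosed K) (hA : IsOpen A)
    (hAK : IsClosed (A ∪ K)) (hb : Bornology.IsBounded A) {a : ℂ}
    (ha : a ∈ A) {g : ℂ → ℂ} (hg : ContinuousOn g K)
    (hge : ∀ z ∈ K, Complex.exp (g z) = z - a) : False := by
  classical
  -- Tietze extends the logarithm over `A`. Replacing `z - a` by `exp ∘ G` on `A` removes its only
  -- zero, so the result has a global logarithm; on a large circle about `a` nothing has changed,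
  -- which is absurd.
  obtain ⟨G, hG⟩ := ContinuousMap.exists_restrict_eq hK ⟨_, hg.domRestrict⟩
  have hGK : ∀ z ∈ K, G z = g z := fun z hz => congrArg (fun f => f ⟨z, hz⟩) hG
  let F : ℂ → ℂ := fun z => if z ∈ A then Complex.exp (G z) else z - a
  have hF1 : ∀ z ∈ A ∪ K, F z = Complex.exp (G z) := by
    intro z hz
    by_cases h : z ∈ A
    · exact if_pos h
    · have hzK := hz.resolve_left h
      rw [hGK z hzK, hge z hzK]
      exact if_neg h
  have hF2 : ∀ z ∈ Aᶜ, F z = z - a := fun z hz => if_neg hz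
  have hF : Continuous F := by
    have hu : (A ∪ K) ∪ Aᶜ = univ := by
      ext z; by_cases h : z ∈ A <;> simp [h]
    rw [← continuousOn_univ, ← hu]
    refine ContinuousOn.union_of_isClosed ?_ ?_ hAK hA.isClosed_compl
    · exact ContinuousOn.congr (by fun_prop) hF1
    · exact ContinuousOn.congr (by fun_prop) hF2
  have hF0 : ∀ z, F z ≠ 0 := by
    intro z
    by_cases h : z ∈ A
    · rw [hF1 z (Or.inl h)]; exact Complex.exp_ne_zero _
    · rw [hF2 z h]
      rintro h'
      exact h (sub_eq_zero.mp h' ▸ ha)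
  obtain ⟨L, hL, hLe⟩ := exists_continuous_log_of_continuous hF hF0
  obtain ⟨R, hR⟩ := hb.subset_ball a
  have hR0 : 0 < R := by
    have := hR ha
    simpa using this
  have hRC : (R : ℂ) ≠ 0 := by exact_mod_cast hR0.ne'
  refine Circle.not_exists_continuous_log (g := fun w => L (a + R * w) - Complex.log R)
    (by fun_prop) fun w => ?_
  have hw : a + R * w ∉ A := fun h => by
    have := hR h
    rw [Metric.mem_ball, dist_eq_norm, add_sub_cancel_left, norm_mul, Circle.norm_coe] at this
    simp [abs_of_pos hR0] at this
  rw [Complex.exp_sub, hLe, hF2 _ hw, Complex.exp_log hRC, add_sub_cancel_left,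
    mul_div_cancel_left₀ _ hRC]

/-- Precomposing `f` with the radial retraction `r` of the plane onto the disc gives a nonvanishing
function on the whole plane, whose logarithm is pulled back along the inverse of `f`. -/
theorem exists_log_on_disc {f : Metric.closedBall (0 : ℂ) 1 → ℂ} (hf : IsEmbedding f) {a : ℂ}
    (ha : a ∉ range f) :
    ∃ g : ℂ → ℂ, ContinuousOn g (range f) ∧ ∀ z ∈ range f, Complex.exp (g z) = z - a := by
  let r : ℂ → Metric.closedBall (0 : ℂ) 1 := fun z => ⟨((max 1 ‖z‖ : ℝ) : ℂ)⁻¹ * z, by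
    have h1 : (0 : ℝ) < max 1 ‖z‖ := lt_max_of_lt_left one_pos
    rw [mem_closedBall_zero_iff, norm_mul, norm_inv, Complex.norm_real, Real.norm_of_nonneg h1.le,
      inv_mul_le_one₀ h1]
    exact le_max_right _ _⟩
  have hr : Continuous r := by
    refine Continuous.subtype_mk (Continuous.mul (Continuous.inv₀ (by fun_prop) fun z => ?_)
      continuous_id) _
    have h1 : (0 : ℝ) < max 1 ‖z‖ := lt_max_of_lt_left one_pos
    exact_mod_cast h1.ne'
  have hrid : ∀ z : Metric.closedBall (0 : ℂ) 1, r z = z := fun z => by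
    apply Subtype.ext
    have : max 1 ‖(z : ℂ)‖ = 1 := max_eq_left (mem_closedBall_zero_iff.mp z.2)
    simp [r, this]
  obtain ⟨L, hL, hLe⟩ := exists_continuous_log_of_continuous (F := fun z => f (r z) - a)
    ((hf.continuous.comp hr).sub continuous_const)
    (fun z h => ha ⟨r z, sub_eq_zero.mp h⟩)
  have : Nonempty (Metric.closedBall (0 : ℂ) 1) := ⟨r 0⟩
  have hinv : ∀ z ∈ range f, f (Function.invFun f z) = z := fun z hz => Function.invFun_eq hz
  refine ⟨fun z => L (Function.invFun f z : Metric.closedBall (0 : ℂ) 1), ?_, fun z hz => ?_⟩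
  · refine (hL.comp continuous_subtype_val).comp_continuousOn ?_
    rw [hf.continuousOn_iff]
    exact continuousOn_id.congr hinv
  · rw [hLe, hrid, hinv z hz]

/-! ### Separation in the sphere -/

/-- Stereographic projection to the complex plane. -/
theorem exists_chart_sphere (v : S2) :
    ∃ e : OpenPartialHomeomorph S2 ℂ, e.source = {v}ᶜ ∧ e.target = univ := by
  have : Fact (Module.finrank ℝ (EuclideanSpace ℝ (Fin 3)) = 2 + 1) := ⟨by simp⟩
  refine ⟨(stereographic' 2 v).trans
    (Complex.orthonormalBasisOneI.repr.symm.toHomeomorph.toOpenPartialHomeomorph), ?_, ?_⟩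
  · ext; simp
  · ext; simp

theorem isPreconnected_setOf_lt_norm (R : ℝ) (hR : 0 ≤ R) : IsPreconnected {z : ℂ | R < ‖z‖} := by
  have h : {z : ℂ | R < ‖z‖} = (fun x : ℝ × Circle => (x.1 : ℂ) * x.2) '' (Ioi R ×ˢ univ) := by
    ext z
    constructor
    · intro hz
      refine ⟨(‖z‖, Circle.exp (Complex.arg z)), ⟨hz, mem_univ _⟩, ?_⟩
      simp [Circle.coe_exp]
    · rintro ⟨⟨r, w⟩, ⟨hr, -⟩, rfl⟩
      have : 0 < r := hR.trans_lt hr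
      rw [mem_ofPred_eq, norm_mul, Circle.norm_coe, mul_one, Complex.norm_real,
        Real.norm_of_nonneg this.le]
      exact hr
  rw [h]
  exact (isPreconnected_Ioi.prod isPreconnected_univ).image _ (by fun_prop)

/-- In the stereographic chart from `v` the exterior of a large disc is a connected punctured
neighbourhood `T` of `v` inside `W`. A separation of `W \ {v}` has `T` on one side; adding `v` to
that side would separate `W`. -/
theorem IsPreconnected.diff_singleton_sphere {W : Set S2} (hW : IsPreconnected W) (hWo : IsOpen W)
    {v : S2} (hv : v ∈ W) : IsPreconnected (W \ {v}) := by
  obtain ⟨e, hes, het⟩ := exists_chart_sphere v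
  have hWc : IsCompact Wᶜ := hWo.isClosed_compl.isCompact
  have hsub : Wᶜ ⊆ e.source := by
    rw [hes]; exact compl_subset_compl.mpr (singleton_subset_iff.mpr hv)
  obtain ⟨R, hR0, hR⟩ :=
    (hWc.image_of_continuousOn (e.continuousOn.mono hsub)).isBounded.subset_closedBall_lt 0 0
  set T : Set S2 := e.symm '' {z : ℂ | R < ‖z‖} with hT
  have hsymm : Continuous e.symm := by
    rw [← continuousOn_univ, ← het]; exact e.continuousOn_symm
  have hTpre : IsPreconnected T :=
    (isPreconnected_setOf_lt_norm R hR0.le).image _ hsymm.continuousOn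
  have hsymm_mem : ∀ z, e.symm z ≠ v := fun z => by
    have := e.map_target (x := z) (by rw [het]; trivial)
    rw [hes] at this
    exact this
  have heq : (insert v T) = (e.symm '' Metric.closedBall 0 R)ᶜ := by
    ext x
    by_cases hx : x = v
    · subst hx
      simp only [mem_insert_iff, true_or, mem_compl_iff, true_iff]
      rintro ⟨z, -, hz⟩
      exact hsymm_mem z hz
    · have hxs : x ∈ e.source := by rw [hes]; exact hx
      have key : ∀ s : Set ℂ, x ∈ e.symm '' s ↔ e x ∈ s := fun s => by
        constructor
        · rintro ⟨z, hz, rfl⟩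
          rwa [e.right_inv (by rw [het]; trivial)]
        · exact fun h => ⟨e x, h, e.left_inv hxs⟩
      rw [mem_insert_iff, mem_compl_iff, hT, key, key]
      simp [hx]
  have hopen : IsOpen (insert v T) := by
    rw [heq]
    exact ((isCompact_closedBall _ _).image hsymm).isClosed.isOpen_compl
  have hTW : T ⊆ W \ {v} := by
    rintro _ ⟨z, hz, rfl⟩
    refine ⟨by_contra fun h => ?_, hsymm_mem z⟩
    have := hR (mem_image_of_mem e h)
    rw [e.right_inv (by rw [het]; trivial), mem_closedBall_zero_iff] at this
    exact not_lt.mpr this hz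
  have main : ∀ u u' : Set S2, IsOpen u → IsOpen u' → W \ {v} ⊆ u ∪ u' →
      (W \ {v}) ∩ (u ∩ u') = ∅ → T ⊆ u → W \ {v} ⊆ u := by
    intro u u' hu hu' hcov hdis hTu
    have hcov' : W ⊆ (u ∪ insert v T) ∪ (u' \ {v}) := by
      intro x hx
      by_cases hxv : x = v
      · exact Or.inl (Or.inr (Or.inl hxv))
      · rcases hcov ⟨hx, hxv⟩ with h | h
        · exact Or.inl (Or.inl h)
        · exact Or.inr ⟨h, hxv⟩
    have hdis' : W ∩ ((u ∪ insert v T) ∩ (u' \ {v})) = ∅ := by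
      rw [eq_empty_iff_forall_notMem]
      rintro x ⟨hxW, hx, hxu', hxv⟩
      refine (eq_empty_iff_forall_notMem.mp hdis) x ⟨⟨hxW, hxv⟩, ?_, hxu'⟩
      rcases hx with h | h | h
      · exact h
      · exact absurd h hxv
      · exact hTu h
    rcases isPreconnected_iff_subset_of_disjoint.mp hW (u ∪ insert v T) (u' \ {v})
      (hu.union hopen) (hu'.sdiff isClosed_singleton) hcov' hdis' with h | h
    · rintro x ⟨hxW, hxv⟩
      rcases h hxW with h | h | h
      · exact h
      · exact absurd h hxv
      · exact hTu h
    · exact absurd rfl (h hv).2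
  rw [isPreconnected_iff_subset_of_disjoint]
  intro u u' hu hu' hcov hdis
  rcases isPreconnected_iff_subset_of_disjoint.mp hTpre u u' hu hu' (hTW.trans hcov)
    (subset_eq_empty (inter_subset_inter_left _ hTW) hdis) with h | h
  · exact Or.inl (main u u' hu hu' hcov hdis h)
  · exact Or.inr (main u' u hu' hu (by rwa [union_comm]) (by rwa [inter_comm u']) h)

/-- A Jordan curve separates the sphere. -/
theorem not_isPreconnected_compl_of_circle_sphere {γ : Circle → S2} (hγ : IsEmbedding γ)
    (hne : range γ ≠ univ) : ¬ IsPreconnected (range γ)ᶜ := by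
  intro hpre
  obtain ⟨v, hv⟩ := (ne_univ_iff_exists_notMem _).mp hne
  obtain ⟨e, hes, het⟩ := exists_chart_sphere v
  have hmem : ∀ w, γ w ∈ e.source := fun w => by
    rw [hes]; rintro rfl; exact hv (mem_range_self w)
  have hpre' := hpre.diff_singleton_sphere
    (isCompact_range hγ.continuous).isClosed.isOpen_compl hv
  refine not_isPreconnected_compl_range_circle (γ := e ∘ γ)
    (e.continuousOn.comp_continuous hγ.continuous hmem)
    (fun a b hab => hγ.injective (e.injOn (hmem a) (hmem b) hab)) ?_
  have himg : (range (e ∘ γ))ᶜ = e '' ((range γ)ᶜ \ {v}) := by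
    ext z
    have hz := e.right_inv (x := z) (by rw [het]; trivial)
    have hz' := e.map_target (x := z) (by rw [het]; trivial)
    constructor
    · intro h
      refine ⟨e.symm z, ⟨?_, by rwa [hes] at hz'⟩, hz⟩
      rintro ⟨w, hw⟩
      exact h ⟨w, by rw [Function.comp_apply, hw, hz]⟩
    · rintro ⟨x, ⟨hx, hxv⟩, rfl⟩ ⟨w, hw⟩
      exact hx ⟨w, e.injOn (hmem w) (by rwa [hes]) hw⟩
  rw [himg]
  exact hpre'.image _ (e.continuousOn.mono (by rw [hes]; exact fun x hx => hx.2))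

/-- A closed disc does not separate the sphere. -/
theorem isPreconnected_compl_disc_sphere {f : Metric.closedBall (0 : ℂ) 1 → S2}
    (hf : IsEmbedding f) : IsPreconnected (range f)ᶜ := by
  have : CompactSpace (Metric.closedBall (0 : ℂ) 1) :=
    isCompact_iff_compactSpace.mp (isCompact_closedBall _ _)
  have hK : IsClosed (range f) := (isCompact_range hf.continuous).isClosed
  rw [isPreconnected_iff_subset_of_disjoint]
  intro u v hu hv hcov hdis
  by_contra! hcon
  obtain ⟨⟨b, hbK, hbu⟩, ⟨a, haK, hav⟩⟩ := And.imp not_subset.mp not_subset.mp hcon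
  have hau : a ∈ u := (hcov haK).resolve_right hav
  have hbv : b ∈ v := (hcov hbK).resolve_left hbu
  -- Projecting from a point of the other side makes `A` bounded, with boundary in the disc, while
  -- `z - e a` has a logarithm on the disc.
  obtain ⟨e, hes, het⟩ := exists_chart_sphere b
  set A := (range f)ᶜ ∩ u
  have hAo : IsOpen A := hK.isOpen_compl.inter hu
  have hAK : A ∪ range f = ((range f)ᶜ ∩ v)ᶜ := by
    ext x
    by_cases hx : x ∈ range f
    · simp [hx]
    · have h1 := hcov hx
      have h2 : ¬ (x ∈ u ∧ x ∈ v) := fun h => (eq_empty_iff_forall_notMem.mp hdis) x ⟨hx, h⟩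
      have h3 : x ∈ A ↔ x ∈ u := ⟨fun h => h.2, fun h => ⟨hx, h⟩⟩
      rw [mem_union, h3, mem_compl_iff, mem_inter_iff, mem_compl_iff]
      have h1' : x ∈ u ∨ x ∈ v := h1
      tauto
  have hsub : A ∪ range f ⊆ e.source := by
    rw [hAK, hes]
    exact compl_subset_compl.mpr (singleton_subset_iff.mpr ⟨hbK, hbv⟩)
  have hcpt : IsCompact (e '' (A ∪ range f)) := by
    refine IsCompact.image_of_continuousOn (IsClosed.isCompact ?_) (e.continuousOn.mono hsub)
    rw [hAK]
    exact (hK.isOpen_compl.inter hv).isClosed_compl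
  have hmem : ∀ w, f w ∈ e.source := fun w => hsub (Or.inr (mem_range_self w))
  have hef : IsEmbedding (e ∘ f) := by
    refine (Continuous.isClosedEmbedding (e.continuousOn.comp_continuous hf.continuous hmem)
      ?_).isEmbedding
    exact fun a b hab => hf.injective (e.injOn (hmem a) (hmem b) hab)
  have hasrc : a ∈ e.source := hsub (Or.inl ⟨haK, hau⟩)
  have ha : e a ∉ range (e ∘ f) := by
    rintro ⟨w, hw⟩
    exact haK ⟨w, e.injOn (hmem w) hasrc hw⟩
  obtain ⟨g, hg, hge⟩ := exists_log_on_disc hef ha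
  rw [image_union, ← range_comp] at hcpt
  exact not_exists_log_of_isBounded (isCompact_range hef.continuous).isClosed
    (e.isOpen_image_of_subset_source hAo (subset_union_left.trans hsub)) hcpt.isClosed
    (hcpt.isBounded.subset subset_union_left) (mem_image_of_mem e ⟨haK, hau⟩) hg hge

/-! ### Complementary components of a Schottky set -/

instance : LocallyConnectedSpace S2 :=
  ChartedSpace.locallyConnectedSpace (EuclideanSpace ℝ (Fin 2)) S2

theorem isConnected_compl_of_subsingleton_circle {s : Set Circle} (hs : s.Subsingleton) :
    IsConnected sᶜ := by
  rcases hs.eq_empty_or_singleton with rfl | ⟨w, rfl⟩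
  · rw [compl_empty]; exact isConnected_univ
  have hpi := Real.pi_pos
  have himg : ({w}ᶜ : Set Circle) = (fun θ => -w * Circle.exp θ) '' Ioo (-Real.pi) Real.pi := by
    ext z
    constructor
    · intro hz
      have h1 : Circle.exp (Complex.arg (-w⁻¹ * z : Circle)) = -w⁻¹ * z := Circle.exp_arg _
      have h2 : -w * Circle.exp (Complex.arg (-w⁻¹ * z : Circle)) = z := by
        rw [h1]; simp
      refine ⟨_, ⟨Complex.neg_pi_lt_arg _, (Complex.arg_le_pi _).lt_of_ne fun h => hz ?_⟩, h2⟩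
      rw [mem_singleton_iff, ← h2, h]
      ext
      simp
    · rintro ⟨θ, hθ, rfl⟩ h
      have h1 : Circle.exp θ = -1 := by
        have h2 : -w * Circle.exp θ = w := h
        calc Circle.exp θ = (-w)⁻¹ * (-w * Circle.exp θ) := (inv_mul_cancel_left _ _).symm
          _ = -1 := by rw [h2]; simp
      have h2 := Circle.arg_exp hθ.1 hθ.2.le
      rw [h1] at h2
      simp at h2
      exact hθ.2.ne h2.symm
  rw [himg]
  exact (isConnected_Ioo (by linarith)).image _ (by fun_prop)

theorem isConnected_range_circle_diff {X : Type*} [TopologicalSpace X] {γ : Circle → X}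
    (hγ : IsEmbedding γ) {s : Set X} (hs : (range γ ∩ s).Subsingleton) :
    IsConnected (range γ \ s) := by
  have h : range γ \ s = γ '' (γ ⁻¹' s)ᶜ := by
    rw [← preimage_compl, image_preimage_eq_range_inter, sdiff_eq]
  rw [h]
  refine (isConnected_compl_of_subsingleton_circle fun a ha b hb => hγ.injective ?_).image _
    hγ.continuous.continuousOn
  exact hs ⟨mem_range_self a, ha⟩ ⟨mem_range_self b, hb⟩

section Components

variable {S D D' : Set S2}

theorem exists_mem_complComponents {x : S2} (hx : x ∉ S) : ∃ D ∈ complComponents S, x ∈ D :=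
  ⟨_, ⟨x, hx, rfl⟩, mem_connectedComponentIn hx⟩

theorem boundaryCircle_subset : boundaryCircle S D ⊆ S := inter_subset_right

theorem subset_compl_of_mem_complComponents (hD : D ∈ complComponents S) : D ⊆ Sᶜ := by
  obtain ⟨x, -, rfl⟩ := hD
  exact connectedComponentIn_subset _ _

theorem isConnected_of_mem_complComponents (hD : D ∈ complComponents S) : IsConnected D := by
  obtain ⟨x, hx, rfl⟩ := hD
  exact isConnected_connectedComponentIn_iff.mpr hx

theorem eq_connectedComponentIn_of_mem (hD : D ∈ complComponents S) {x : S2} (hx : x ∈ D) :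
    D = connectedComponentIn Sᶜ x := by
  obtain ⟨y, -, rfl⟩ := hD
  exact connectedComponentIn_eq hx

theorem eq_of_mem_complComponents (hD : D ∈ complComponents S) (hD' : D' ∈ complComponents S)
    {x : S2} (hx : x ∈ D) (hx' : x ∈ D') : D = D' := by
  rw [eq_connectedComponentIn_of_mem hD hx, eq_connectedComponentIn_of_mem hD' hx']

namespace IsTopologicalSchottkySet

variable (hS : IsTopologicalSchottkySet S)

include hS

theorem isClosed : IsClosed S := hS.isCompact.isClosed

theorem isOpen_component (hD : D ∈ complComponents S) : IsOpen D := by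
  obtain ⟨x, -, rfl⟩ := hD
  exact hS.isClosed.isOpen_compl.connectedComponentIn

theorem disjoint_closure (hD : D ∈ complComponents S) (hD' : D' ∈ complComponents S)
    (hne : D ≠ D') {x : S2} (hx : x ∈ D') : x ∉ closure D := by
  intro hxD
  obtain ⟨y, hy', hy⟩ := mem_closure_iff.mp hxD D' (hS.isOpen_component hD') hx
  exact hne (eq_of_mem_complComponents hD hD' hy hy')

theorem boundaryCircle_eq (hD : D ∈ complComponents S) : boundaryCircle S D = closure D \ D := by
  ext x
  refine ⟨fun h => ⟨h.1, fun hx => subset_compl_of_mem_complComponents hD hx h.2⟩,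
    fun h => ⟨h.1, by_contra fun hx => ?_⟩⟩
  obtain ⟨D', hD', hxD'⟩ := exists_mem_complComponents hx
  by_cases hne : D = D'
  · exact h.2 (hne ▸ hxD')
  · exact hS.disjoint_closure hD hD' hne hxD' h.1

/-- A parametrization of the closure of a complementary component by the closed disc. -/
theorem exists_disc (hD : D ∈ complComponents S) :
    ∃ f : Metric.closedBall (0 : ℂ) 1 → S2, IsEmbedding f ∧ range f = closure D ∧
      (∀ z, f z ∈ D ↔ ‖(z : ℂ)‖ < 1) ∧ ∀ z, f z ∈ boundaryCircle S D ↔ ‖(z : ℂ)‖ = 1 := by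
  obtain ⟨f, hf, hr, hi⟩ := hS.jordan D hD
  have h1 : ∀ z, f z ∈ D ↔ ‖(z : ℂ)‖ < 1 := fun z => by
    rw [← hi]
    exact hf.injective.mem_set_image (s := {z | ‖(z : ℂ)‖ < 1})
  refine ⟨f, hf, hr, h1, fun z => ?_⟩
  have h2 : ‖(z : ℂ)‖ ≤ 1 := mem_closedBall_zero_iff.mp z.2
  have h3 : f z ∈ closure D := hr ▸ mem_range_self z
  rw [hS.boundaryCircle_eq hD, mem_sdiff, h1]
  constructor
  · exact fun h => le_antisymm h2 (not_lt.mp h.2)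
  · exact fun h => ⟨h3, h.not_lt⟩

theorem exists_circle (hD : D ∈ complComponents S) :
    ∃ γ : Circle → S2, IsEmbedding γ ∧ range γ = boundaryCircle S D := by
  obtain ⟨f, hf, hr, -, hb⟩ := hS.exists_disc hD
  let ι : Circle → Metric.closedBall (0 : ℂ) 1 := fun w => ⟨w, mem_closedBall_zero_iff.mpr (Circle.norm_coe w).le⟩
  have hι : Continuous ι := by fun_prop
  refine ⟨f ∘ ι, ((hf.continuous.comp hι).isClosedEmbedding ?_).isEmbedding, ?_⟩
  · exact hf.injective.comp fun a b hab => Circle.ext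
        (congrArg (fun z : Metric.closedBall (0 : ℂ) 1 => (z : ℂ)) hab)
  · ext x
    constructor
    · rintro ⟨w, rfl⟩
      exact (hb _).mpr (Circle.norm_coe w)
    · intro hx
      obtain ⟨z, rfl⟩ : x ∈ range f := hr ▸ hx.1
      exact ⟨⟨z, mem_sphere_zero_iff_norm.mpr ((hb z).mp hx)⟩, rfl⟩

theorem boundaryCircle_nontrivial (hD : D ∈ complComponents S) :
    (boundaryCircle S D).Nontrivial := by
  obtain ⟨γ, hγ, hr⟩ := hS.exists_circle hD
  rw [← hr]
  refine ⟨γ 1, mem_range_self _, γ (-1), mem_range_self _, fun h => ?_⟩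
  have := congrArg Subtype.val (hγ.injective h)
  norm_num [Complex.ext_iff] at this

/-- Two components with the same circle would have closures sharing more than one point. -/
theorem boundaryCircle_injOn : InjOn (boundaryCircle S) (complComponents S) := by
  intro D hD D' hD' h
  by_contra hne
  refine (hS.boundaryCircle_nontrivial hD).not_subsingleton ((hS.pair D hD D' hD' hne).anti ?_)
  exact fun x hx => ⟨hx.1, (h ▸ hx : x ∈ boundaryCircle S D').1⟩

theorem isConnected_boundaryCircle_diff (hD : D ∈ complComponents S)
    (hD' : D' ∈ complComponents S) (hne : D ≠ D') :
    IsConnected (boundaryCircle S D' \ boundaryCircle S D) := by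
  obtain ⟨γ, hγ, hr⟩ := hS.exists_circle hD'
  rw [← hr]
  refine isConnected_range_circle_diff hγ ((hS.pair D hD D' hD' hne).anti ?_)
  rw [hr]
  exact fun x hx => ⟨hx.2.1, hx.1.1⟩

/-! ### Nullity of the components, and the non-separating circles -/

/-- The complementary components form a null family. -/
theorem exists_finite_nhds (x : S2) {V : Set S2} (hV : V ∈ 𝓝 x) :
    ∃ F : Set (Set S2), F.Finite ∧ ∃ W ∈ 𝓝 x, ∀ D ∈ complComponents S, D ∉ F →
      (D ∩ W).Nonempty → closure D ⊆ V := by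
  obtain ⟨ε, hε, hεV⟩ := Metric.mem_nhds_iff.mp hV
  have hr : 0 < ε / 4 := by linarith
  -- `F` collects the components contained in no ball of radius `ε / 4`. Any other component coming
  -- within `ε / 4` of `x` has its closure within `3 * ε / 4` of `x`.
  refine ⟨_, hS.cover (range fun c : S2 => Metric.ball c (ε / 4)) ?_ ?_, _,
    Metric.ball_mem_nhds x hr, ?_⟩
  · rintro _ ⟨c, rfl⟩
    exact Metric.isOpen_ball
  · exact eq_univ_of_forall fun c => ⟨_, mem_range_self c, Metric.mem_ball_self hr⟩
  · rintro D hD hDF ⟨y, hyD, hyx⟩ z hz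
    obtain ⟨_, ⟨c, rfl⟩, hDc⟩ := not_not.mp fun h => hDF ⟨hD, h⟩
    have hzc : dist z c ≤ ε / 4 := Metric.closure_ball_subset_closedBall (closure_mono hDc hz)
    have hyc : dist y c < ε / 4 := hDc hyD
    have hyx' : dist y x < ε / 4 := hyx
    refine hεV ?_
    have h1 := dist_triangle z c x
    have h2 := dist_triangle_left c x y
    rw [Metric.mem_ball]
    linarith

theorem isPreconnected_diff_boundaryCircle (hD : D ∈ complComponents S) :
    IsPreconnected (S \ boundaryCircle S D) := by
  set C := boundaryCircle S D with hC
  have hUpre : IsPreconnected (closure D)ᶜ := by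
    obtain ⟨f, hf, hr, -⟩ := hS.exists_disc hD
    rw [← hr]
    exact isPreconnected_compl_disc_sphere hf
  have hTU : ∀ {x}, x ∈ S \ C ↔ x ∈ S ∧ x ∈ (closure D)ᶜ := fun {x} =>
    ⟨fun h => ⟨h.1, fun h' => h.2 ⟨h', h.1⟩⟩, fun h => ⟨h.1, fun h' => h.2 h'.1⟩⟩
  have hCT : ∀ D', boundaryCircle S D' \ C ⊆ S \ C := fun D' x hx => ⟨hx.1.2, hx.2⟩
  -- The side `u` of the splitting, with the discs filled in whose circles, minus `C`, lie in `u`.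
  let A : Set S2 → Set S2 := fun u => (S \ C) ∩ u ∪
    ⋃ D' ∈ {D' ∈ complComponents S | D ≠ D' ∧ boundaryCircle S D' \ C ⊆ u}, D'
  have hAmem : ∀ {u D' x}, D' ∈ complComponents S → D ≠ D' → boundaryCircle S D' \ C ⊆ u →
      x ∈ D' → x ∈ A u := fun h1 h2 h3 h4 => Or.inr (mem_biUnion ⟨h1, h2, h3⟩ h4)
  have hAS : ∀ {u x}, x ∈ S → x ∈ A u → x ∈ u := by
    rintro u x hx (h | h)
    · exact h.2
    · obtain ⟨D', hD', hxD'⟩ := mem_iUnion₂.mp h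
      exact absurd hx (subset_compl_of_mem_complComponents hD'.1 hxD')
  have hopen : ∀ u : Set S2, IsOpen u → (∀ D' ∈ complComponents S, D ≠ D' →
      ∀ x ∈ boundaryCircle S D' \ C, x ∈ u → boundaryCircle S D' \ C ⊆ u) → IsOpen (A u) := by
    intro u hu hall
    rw [isOpen_iff_mem_nhds]
    rintro x (⟨hxT, hxu⟩ | hx)
    · have hxU := (hTU.mp hxT).2
      have hV : u ∩ (closure D)ᶜ ∈ 𝓝 x :=
        (hu.inter isClosed_closure.isOpen_compl).mem_nhds ⟨hxu, hxU⟩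
      -- Near `x`, components outside `F` have closure in `u`. The finitely many in `F` either stay
      -- away from `x` or have `x` on their circle, which then lies in `u` apart from `C`.
      obtain ⟨F, hF, W, hW, hFW⟩ := hS.exists_finite_nhds x hV
      have hN : ⋂ D' ∈ {D' ∈ F | x ∉ closure D'}, (closure D')ᶜ ∈ 𝓝 x := by
        rw [Filter.biInter_mem (hF.subset (sep_subset _ _))]
        exact fun D' hD' => isClosed_closure.isOpen_compl.mem_nhds hD'.2
      filter_upwards [hV, hW, hN] with y hyV hyW hyN
      by_cases hyS : y ∈ S
      · exact Or.inl ⟨hTU.mpr ⟨hyS, hyV.2⟩, hyV.1⟩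
      obtain ⟨D', hD', hyD'⟩ := exists_mem_complComponents hyS
      have hne : D ≠ D' := by
        rintro rfl
        exact hyV.2 (subset_closure hyD')
      refine hAmem hD' hne ?_ hyD'
      by_cases hD'F : D' ∈ F
      · have hxD' : x ∈ closure D' := by
          by_contra h
          exact mem_iInter₂.mp hyN D' ⟨hD'F, h⟩ (subset_closure hyD')
        exact hall D' hD' hne x ⟨⟨hxD', hxT.1⟩, hxT.2⟩ hxu
      · obtain ⟨c, hc⟩ := (hS.isConnected_boundaryCircle_diff hD hD' hne).nonempty
        exact hall D' hD' hne c hc (hFW D' hD' hD'F ⟨y, hyD', hyW⟩ hc.1.1).1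
    · obtain ⟨D', hD', hxD'⟩ := mem_iUnion₂.mp hx
      exact Filter.mem_of_superset ((hS.isOpen_component hD'.1).mem_nhds hxD')
        fun y hy => hAmem hD'.1 hD'.2.1 hD'.2.2 hy
  rw [isPreconnected_iff_subset_of_disjoint]
  intro u v hu hv hcov hdis
  have hnot : ∀ x ∈ S \ C, x ∈ u → x ∉ v := fun x hx hxu hxv =>
    eq_empty_iff_forall_notMem.mp hdis x ⟨hx, hxu, hxv⟩
  have hdich : ∀ D' ∈ complComponents S, D ≠ D' →
      boundaryCircle S D' \ C ⊆ u ∨ boundaryCircle S D' \ C ⊆ v := fun D' hD' hne =>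
    isPreconnected_iff_subset_of_disjoint.mp
      (hS.isConnected_boundaryCircle_diff hD hD' hne).isPreconnected u v hu hv
      ((hCT D').trans hcov) (subset_eq_empty (inter_subset_inter_left _ (hCT D')) hdis)
  have hAu : IsOpen (A u) := hopen u hu fun D' hD' hne x hx hxu =>
    (hdich D' hD' hne).resolve_right fun h => hnot x (hCT D' hx) hxu (h hx)
  have hAv : IsOpen (A v) := hopen v hv fun D' hD' hne x hx hxv =>
    (hdich D' hD' hne).resolve_left fun h => hnot x (hCT D' hx) (h hx) hxv
  have hcovA : (closure D)ᶜ ⊆ A u ∪ A v := by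
    intro x hx
    by_cases hxS : x ∈ S
    · have hxT := hTU.mpr ⟨hxS, hx⟩
      exact (hcov hxT).imp (fun h => Or.inl ⟨hxT, h⟩) (fun h => Or.inl ⟨hxT, h⟩)
    · obtain ⟨D', hD', hxD'⟩ := exists_mem_complComponents hxS
      have hne : D ≠ D' := by
        rintro rfl
        exact hx (subset_closure hxD')
      exact (hdich D' hD' hne).imp (fun h => hAmem hD' hne h hxD') (fun h => hAmem hD' hne h hxD')
  have hdisA : (closure D)ᶜ ∩ (A u ∩ A v) = ∅ := by
    rw [eq_empty_iff_forall_notMem]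
    rintro x ⟨hx, hxu, hxv⟩
    by_cases hxS : x ∈ S
    · exact hnot x (hTU.mpr ⟨hxS, hx⟩) (hAS hxS hxu) (hAS hxS hxv)
    · obtain ⟨D₁, h₁, hx₁⟩ := mem_iUnion₂.mp (hxu.resolve_left fun h => hxS h.1.1)
      obtain ⟨D₂, h₂, hx₂⟩ := mem_iUnion₂.mp (hxv.resolve_left fun h => hxS h.1.1)
      obtain rfl := eq_of_mem_complComponents h₁.1 h₂.1 hx₁ hx₂
      obtain ⟨c, hc⟩ := (hS.isConnected_boundaryCircle_diff hD h₁.1 h₁.2.1).nonempty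
      exact hnot c (hCT _ hc) (h₁.2.2 hc) (h₂.2.2 hc)
  exact (isPreconnected_iff_subset_of_disjoint.mp hUpre _ _ hAu hAv hcovA hdisA).imp
    (fun h x hx => hAS hx.1 (h (hTU.mp hx).2)) (fun h x hx => hAS hx.1 (h (hTU.mp hx).2))

/-- For nonemptiness: if `S` were the circle of `D`, any other component would have its whole circle
in `closure D`. So `Sᶜ = D` would be connected, against Jordan separation. -/
theorem isConnected_diff_boundaryCircle (hD : D ∈ complComponents S) :
    IsConnected (S \ boundaryCircle S D) := by
  refine ⟨?_, hS.isPreconnected_diff_boundaryCircle hD⟩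
  by_contra hemp
  have hSC : S = boundaryCircle S D :=
    Subset.antisymm (sdiff_eq_empty.mp (not_nonempty_iff_eq_empty.mp hemp)) inter_subset_right
  obtain ⟨γ, hγ, hr⟩ := hS.exists_circle hD
  have hrS : range γ = S := hr.trans hSC.symm
  refine not_isPreconnected_compl_of_circle_sphere hγ (hrS ▸ hS.proper) ?_
  have hcompl : Sᶜ = D := by
    refine Subset.antisymm (fun x hx => ?_) (subset_compl_of_mem_complComponents hD)
    obtain ⟨D', hD', hxD'⟩ := exists_mem_complComponents hx
    by_cases hne : D = D'
    · exact hne ▸ hxD'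
    · refine absurd ((hS.pair D hD D' hD' hne).anti fun y hy => ⟨?_, hy.1⟩)
        (hS.boundaryCircle_nontrivial hD').not_subsingleton
      exact (hSC ▸ hy.2 : y ∈ boundaryCircle S D).1
  rw [hrS, hcompl]
  exact (isConnected_of_mem_complComponents hD).isPreconnected

theorem exists_eq_boundaryCircle {C : Set S2} (hC : IsEmbeddedCircleIn S C)
    (hCS : IsNonseparatingIn S C) : ∃ D ∈ complComponents S, C = boundaryCircle S D := by
  obtain ⟨hsub, γ, hγ, rfl⟩ := hC
  set C := range γ
  have hCo : IsOpen Cᶜ := (isCompact_range hγ.continuous).isClosed.isOpen_compl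
  have hCne : C ≠ univ := fun h => hS.proper (univ_subset_iff.mp (h ▸ hsub))
  have hnp := not_isPreconnected_compl_of_circle_sphere hγ hCne
  obtain ⟨x₀, hx₀⟩ := hCS.nonempty
  have hSV : S \ C ⊆ connectedComponentIn Cᶜ x₀ :=
    hCS.isPreconnected.subset_connectedComponentIn hx₀ fun x hx => hx.2
  obtain ⟨y, hyC, hyV⟩ : ∃ y ∈ Cᶜ, y ∉ connectedComponentIn Cᶜ x₀ := by
    by_contra! h
    refine hnp ?_
    rw [Subset.antisymm h (connectedComponentIn_subset _ _)]
    exact isPreconnected_connectedComponentIn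
  have hWS : connectedComponentIn Cᶜ y ⊆ Sᶜ := by
    intro z hz hzS
    have h1 := hSV ⟨hzS, connectedComponentIn_subset _ _ hz⟩
    rw [connectedComponentIn_eq h1, ← connectedComponentIn_eq hz] at hyV
    exact hyV (mem_connectedComponentIn hyC)
  have hyW : y ∈ connectedComponentIn Cᶜ y := mem_connectedComponentIn hyC
  have hyS := hWS hyW
  set D := connectedComponentIn Sᶜ y
  have hD : D ∈ complComponents S := ⟨y, hyS, rfl⟩
  -- Removing `S` instead of the smaller `C` does not change the component of `y`, since the larger
  -- candidate already misses `S`.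
  have hDW : D = connectedComponentIn Cᶜ y := Subset.antisymm
    (connectedComponentIn_mono _ (compl_subset_compl.mpr hsub))
    (isPreconnected_connectedComponentIn.subset_connectedComponentIn hyW hWS)
  have hDC : boundaryCircle S D ⊆ C := by
    rintro x ⟨hxD, hxS⟩
    by_contra hxC
    obtain ⟨z, hz, hzD⟩ := mem_closure_iff.mp hxD _ (hCo.connectedComponentIn (x := x))
      (mem_connectedComponentIn hxC)
    rw [hDW] at hzD
    have hx : x ∈ connectedComponentIn Cᶜ y := by
      rw [connectedComponentIn_eq hzD, ← connectedComponentIn_eq hz]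
      exact mem_connectedComponentIn hxC
    exact hWS hx hxS
  obtain ⟨γ', hγ', hr⟩ := hS.exists_circle hD
  refine ⟨D, hD, ?_⟩
  rw [← hr] at hDC ⊢
  exact (range_eq_of_range_subset_of_isEmbedding_circle hγ' hγ hDC).symm

theorem setOf_nonseparating_circles_eq :
    {C : Set S2 | IsEmbeddedCircleIn S C ∧ IsNonseparatingIn S C} =
      {C : Set S2 | ∃ D ∈ complComponents S, C = boundaryCircle S D} := by
  ext C
  constructor
  · exact fun h => hS.exists_eq_boundaryCircle h.1 h.2
  · rintro ⟨D, hD, rfl⟩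
    exact ⟨⟨inter_subset_right, hS.exists_circle hD⟩, hS.isConnected_diff_boundaryCircle hD⟩

end IsTopologicalSchottkySet

end Components

/-! ### Extension of homeomorphisms -/

/-- Every self-homeomorphism of the circle extends to the disc by coning. -/
theorem exists_cone_extension {φ : Circle → Circle} (hφ : Continuous φ)
    (hbij : Function.Bijective φ) :
    ∃ c : Metric.closedBall (0 : ℂ) 1 → Metric.closedBall (0 : ℂ) 1, Continuous c ∧
      Function.Bijective c ∧ (∀ z, ‖(c z : ℂ)‖ = ‖(z : ℂ)‖) ∧
      ∀ (w : Circle) (z : Metric.closedBall (0 : ℂ) 1), (z : ℂ) = w → (c z : ℂ) = φ w := by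
  classical
  -- The direction of `z`. Its value `1` at the origin is harmless, because the cone map multiplies
  -- by `‖z‖`.
  let d : ℂ → Circle := fun z => Circle.exp (Complex.arg z)
  have hd : ∀ z : ℂ, (‖z‖ : ℂ) * d z = z := fun z => by simp [d, Circle.coe_exp]
  have hdmul : ∀ (r : ℝ) (w : Circle), 0 < r → d (r * w) = w := fun r w hr => by
    simp only [d, Complex.arg_real_mul _ hr, Circle.exp_arg]
  have hdc : ContinuousOn d {0}ᶜ := by
    have hemb : IsEmbedding (X := Circle) (fun w => (w : ℂ)) := IsEmbedding.subtypeVal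
    rw [hemb.continuousOn_iff]
    refine ContinuousOn.congr (f := fun z : ℂ => z / ‖z‖) ?_ fun z hz => ?_
    · refine continuousOn_id.div (by fun_prop) fun z hz => ?_
      simpa using hz
    · have : (‖z‖ : ℂ) ≠ 0 := by simpa using hz
      rw [Function.comp_apply, eq_div_iff this, mul_comm, hd]
  let k : ℂ → ℂ := fun z => ‖z‖ * φ (d z)
  have hkn : ∀ z, ‖k z‖ = ‖z‖ := fun z => by simp [k, Circle.norm_coe]
  have hk : Continuous k := by
    rw [continuous_iff_continuousAt]
    intro z
    by_cases hz : z = 0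
    · subst hz
      have hk0 : k 0 = 0 := by simp [k]
      rw [ContinuousAt, hk0, tendsto_zero_iff_norm_tendsto_zero]
      simp only [hkn]
      exact tendsto_norm_zero
    · have h1 : ContinuousAt d z := hdc.continuousAt (isOpen_compl_singleton.mem_nhds hz)
      exact ContinuousAt.mul (by fun_prop)
        ((continuous_subtype_val.comp hφ).continuousAt.comp h1)
  refine ⟨fun z => ⟨k z, by rw [mem_closedBall_zero_iff, hkn]; exact mem_closedBall_zero_iff.mp z.2⟩,
    by fun_prop, ⟨?_, ?_⟩, fun z => hkn z, ?_⟩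
  · intro a b hab
    have hab' : k a = k b := Subtype.ext_iff.mp hab
    have hn : ‖(a : ℂ)‖ = ‖(b : ℂ)‖ := by rw [← hkn, hab', hkn]
    apply Subtype.ext
    by_cases h0 : ‖(b : ℂ)‖ = 0
    · rw [norm_eq_zero.mp h0, norm_eq_zero.mp (hn.trans h0)]
    · have h1 : (‖(b : ℂ)‖ : ℂ) ≠ 0 := by exact_mod_cast h0
      simp only [k, hn] at hab'
      have h2 := hbij.1 (Circle.ext (mul_left_cancel₀ h1 hab'))
      rw [← hd a, ← hd b, h2, hn]
  · intro b
    obtain ⟨w, hw⟩ := hbij.2 (d b)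
    have hb := mem_closedBall_zero_iff.mp b.2
    refine ⟨⟨‖(b : ℂ)‖ * w, by simpa [Circle.norm_coe] using hb⟩, Subtype.ext ?_⟩
    have hn : ‖(‖(b : ℂ)‖ : ℂ) * (w : ℂ)‖ = ‖(b : ℂ)‖ := by simp [Circle.norm_coe]
    change (‖(‖(b : ℂ)‖ : ℂ) * (w : ℂ)‖ : ℂ) * φ (d (‖(b : ℂ)‖ * w)) = b
    rw [hn]
    by_cases h0 : ‖(b : ℂ)‖ = 0
    · rw [norm_eq_zero.mp h0]; simp
    · rw [hdmul _ _ (lt_of_le_of_ne (norm_nonneg _) (Ne.symm h0)), hw, hd]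
  · intro w z hz
    change (‖(z : ℂ)‖ : ℂ) * φ (d z) = φ w
    have h1 := hdmul 1 w one_pos
    rw [Complex.ofReal_one, one_mul] at h1
    rw [hz, h1, Circle.norm_coe, Complex.ofReal_one, one_mul]

/-- The image of a subset of `S₁` under a homeomorphism onto `S₂`. -/
def transport {S₁ S₂ : Set S2} (h : S₁ ≃ₜ S₂) (C : Set S2) : Set S2 :=
  (fun x : S₁ => (h x : S2)) '' (Subtype.val ⁻¹' C)

/-! ### Matching boundary circles and gluing the extensions -/

section Transport

variable {S₁ S₂ : Set S2} (h : S₁ ≃ₜ S₂)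

theorem coe_mem_transport {C : Set S2} {x : S₁} : (h x : S2) ∈ transport h C ↔ (x : S2) ∈ C := by
  constructor
  · rintro ⟨y, hy, hyx⟩
    rwa [← h.injective (Subtype.ext hyx)]
  · exact fun hx => ⟨x, hx, rfl⟩

theorem transport_symm_transport {C : Set S2} (hC : C ⊆ S₂) :
    transport h (transport h.symm C) = C := by
  ext y
  constructor
  · rintro ⟨x, hx, rfl⟩
    have := coe_mem_transport h.symm (C := C) (x := h x)
    rw [h.symm_apply_apply] at this
    exact this.mp hx
  · intro hy
    have h1 := (coe_mem_transport h.symm (x := ⟨y, hC hy⟩)).mpr hy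
    have h2 := (coe_mem_transport h).mpr h1
    rwa [h.apply_symm_apply] at h2

theorem transport_injOn : InjOn (transport h) {C | C ⊆ S₁} := by
  intro C hC C' hC' heq
  have key : ∀ {C}, C ⊆ S₁ → transport h.symm (transport h C) = C :=
    transport_symm_transport h.symm
  rw [← key hC, heq, key hC']

theorem IsEmbeddedCircleIn.transport {C : Set S2} (hC : IsEmbeddedCircleIn S₁ C) :
    IsEmbeddedCircleIn S₂ (transport h C) := by
  obtain ⟨hsub, γ, hγ, rfl⟩ := hC
  refine ⟨?_, fun w => h ⟨γ w, hsub (mem_range_self w)⟩, ?_, ?_⟩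
  · rintro _ ⟨x, -, rfl⟩
    exact (h x).2
  · exact IsEmbedding.subtypeVal.comp (h.isEmbedding.comp (hγ.codRestrict S₁ _))
  · ext y
    constructor
    · rintro ⟨w, rfl⟩
      exact (coe_mem_transport h).mpr (mem_range_self w)
    · rintro ⟨x, ⟨w, hw⟩, rfl⟩
      exact ⟨w, congrArg (fun x => (h x : S2)) (Subtype.ext hw)⟩

theorem IsNonseparatingIn.transport {C : Set S2} (hC : IsNonseparatingIn S₁ C) :
    IsNonseparatingIn S₂ (transport h C) := by
  have h1 : S₂ \ _root_.transport h C =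
      (fun x : S₁ => (h x : S2)) '' (Subtype.val ⁻¹' (S₁ \ C)) := by
    ext y
    constructor
    · rintro ⟨hy, hyC⟩
      obtain ⟨x, hx⟩ := h.surjective ⟨y, hy⟩
      have hxy : (h x : S2) = y := congrArg Subtype.val hx
      rw [← hxy, coe_mem_transport] at hyC
      exact ⟨x, ⟨x.2, hyC⟩, hxy⟩
    · rintro ⟨x, hx, rfl⟩
      exact ⟨(h x).2, fun hh => hx.2 ((coe_mem_transport h).mp hh)⟩
  have h2 : IsConnected (Subtype.val ⁻¹' (S₁ \ C) : Set S₁) := by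
    rw [IsNonseparatingIn] at hC
    refine ⟨?_, ?_⟩
    · obtain ⟨x, hx⟩ := hC.nonempty
      exact ⟨⟨x, hx.1⟩, hx⟩
    · rw [← IsInducing.subtypeVal.isPreconnected_image, Subtype.image_preimage_coe,
        inter_eq_right.mpr sdiff_subset]
      exact hC.isPreconnected
  rw [IsNonseparatingIn, h1]
  exact h2.image _ (by fun_prop)

theorem exists_boundaryCircle_eq_transport (h₁ : IsTopologicalSchottkySet S₁)
    (h₂ : IsTopologicalSchottkySet S₂) {D : Set S2} (hD : D ∈ complComponents S₁) :
    ∃ D' ∈ complComponents S₂, transport h (boundaryCircle S₁ D) = boundaryCircle S₂ D' :=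
  h₂.exists_eq_boundaryCircle
    (IsEmbeddedCircleIn.transport h ⟨inter_subset_right, h₁.exists_circle hD⟩)
    (IsNonseparatingIn.transport h (h₁.isConnected_diff_boundaryCircle hD))

/-- A homeomorphism between boundary circles extends over the complementary discs. -/
theorem exists_extension_component (h₁ : IsTopologicalSchottkySet S₁)
    (h₂ : IsTopologicalSchottkySet S₂) {D D' : Set S2} (hD : D ∈ complComponents S₁)
    (hD' : D' ∈ complComponents S₂)
    (hDD' : transport h (boundaryCircle S₁ D) = boundaryCircle S₂ D') :
    ∃ E : S2 → S2, ContinuousOn E (closure D) ∧ BijOn E D D' ∧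
      ∀ x : S₁, (x : S2) ∈ closure D → E x = h x := by
  obtain ⟨f, hf, hfr, hfD, hfC⟩ := h₁.exists_disc hD
  obtain ⟨f', hf', hfr', hfD', hfC'⟩ := h₂.exists_disc hD'
  let ι : Circle → Metric.closedBall (0 : ℂ) 1 :=
    fun w => ⟨w, mem_closedBall_zero_iff.mpr (Circle.norm_coe w).le⟩
  have hι : Continuous ι := by fun_prop
  have hιi : Function.Injective ι := fun a b hab => Circle.ext
        (congrArg (fun z : Metric.closedBall (0 : ℂ) 1 => (z : ℂ)) hab)
  have hιr : ∀ z : Metric.closedBall (0 : ℂ) 1, ‖(z : ℂ)‖ = 1 → ∃ w, ι w = z := fun z hz =>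
    ⟨⟨z, mem_sphere_zero_iff_norm.mpr hz⟩, rfl⟩
  have hιC : ∀ w, f (ι w) ∈ boundaryCircle S₁ D := fun w => (hfC _).mpr (Circle.norm_coe w)
  have hιC' : ∀ w, f' (ι w) ∈ boundaryCircle S₂ D' := fun w => (hfC' _).mpr (Circle.norm_coe w)
  -- In the two disc parametrizations `h` becomes a self-map `φ` of the unit circle, ready for
  -- coning.
  have hpt : ∀ w, ∃ w', f' (ι w') = h ⟨f (ι w), (hιC w).2⟩ := fun w => by
    have h3 : (h ⟨f (ι w), (hιC w).2⟩ : S2) ∈ boundaryCircle S₂ D' := by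
      rw [← hDD', coe_mem_transport]
      exact hιC w
    obtain ⟨z, hz⟩ : (h ⟨f (ι w), (hιC w).2⟩ : S2) ∈ range f' := hfr' ▸ h3.1
    obtain ⟨w', rfl⟩ := hιr z ((hfC' z).mp (hz ▸ h3))
    exact ⟨w', hz⟩
  choose φ hφ using hpt
  have hφc : Continuous φ := by
    have he : IsEmbedding (f' ∘ ι) :=
      ((hf'.continuous.comp hι).isClosedEmbedding (hf'.injective.comp hιi)).isEmbedding
    rw [he.continuous_iff]
    have : (f' ∘ ι) ∘ φ = fun w => (h ⟨f (ι w), (hιC w).2⟩ : S2) := funext hφ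
    rw [this]
    have := hf.continuous
    fun_prop
  have hφb : Function.Bijective φ := by
    constructor
    · intro a b hab
      have h3 : (h ⟨f (ι a), (hιC a).2⟩ : S2) = h ⟨f (ι b), (hιC b).2⟩ := by
        rw [← hφ, ← hφ, hab]
      exact hιi (hf.injective (Subtype.ext_iff.mp (h.injective (Subtype.ext h3))))
    · intro w'
      have h3 := hιC' w'
      rw [← hDD'] at h3
      obtain ⟨x, hx, hxw⟩ := h3
      obtain ⟨z, hz⟩ : (x : S2) ∈ range f := hfr ▸ hx.1
      obtain ⟨w, rfl⟩ := hιr z ((hfC z).mp (hz ▸ hx))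
      refine ⟨w, hιi (hf'.injective ?_)⟩
      rw [hφ, ← hxw]
      exact congrArg (fun x => (h x : S2)) (Subtype.ext hz)
  obtain ⟨c, hc, hcb, hcn, hcφ⟩ := exists_cone_extension hφc hφb
  have : Nonempty (Metric.closedBall (0 : ℂ) 1) := ⟨ι 1⟩
  have hleft : ∀ z, Function.invFun f (f z) = z := Function.leftInverse_invFun hf.injective
  have hE : ∀ z, f' (c (Function.invFun f (f z))) = f' (c z) := fun z => by rw [hleft]
  -- Off `closure D` the value of `invFun` is junk; only the restriction to `closure D` is used.
  refine ⟨fun x => f' (c (Function.invFun f x)), ?_, ⟨?_, ?_, ?_⟩, ?_⟩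
  · refine (hf'.continuous.comp hc).comp_continuousOn ?_
    rw [hf.continuousOn_iff]
    exact continuousOn_id.congr fun x hx => Function.invFun_eq (hfr ▸ hx : x ∈ range f)
  · intro x hx
    obtain ⟨z, rfl⟩ : x ∈ range f := hfr ▸ subset_closure hx
    change f' _ ∈ D'
    rw [hE, hfD', hcn, ← hfD]
    exact hx
  · intro x hx y hy hxy
    obtain ⟨z, rfl⟩ : x ∈ range f := hfr ▸ subset_closure hx
    obtain ⟨z', rfl⟩ : y ∈ range f := hfr ▸ subset_closure hy
    change f' _ = f' _ at hxy
    rw [hE, hE] at hxy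
    rw [hcb.1 (hf'.injective hxy)]
  · intro y hy
    obtain ⟨z', rfl⟩ : y ∈ range f' := hfr' ▸ subset_closure hy
    obtain ⟨z, rfl⟩ := hcb.2 z'
    refine ⟨f z, ?_, hE z⟩
    rwa [hfD, ← hcn, ← hfD']
  · rintro ⟨x, hxS⟩ hx
    obtain ⟨z, rfl⟩ : x ∈ range f := hfr ▸ hx
    obtain ⟨w, rfl⟩ := hιr z ((hfC z).mp ⟨hx, hxS⟩)
    change f' _ = _
    rw [hE, ← hφ w]
    exact congrArg f' (Subtype.ext (hcφ w (ι w) rfl))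

/-- The delicate point is continuity at `x ∈ S₁`, where infinitely many discs may accumulate: small
discs near `x` must go to small discs near `H x`, which needs nullity in both the source and the
target. -/
theorem exists_homeomorph_extension (h₁ : IsTopologicalSchottkySet S₁)
    (h₂ : IsTopologicalSchottkySet S₂) :
    ∃ H : S2 ≃ₜ S2, ∀ x : S₁, H (x : S2) = (h x : S2) := by
  classical
  have : Nonempty (S2 → S2) := ⟨id⟩
  choose! σ hσ hσC using fun D (hD : D ∈ complComponents S₁) =>
    exists_boundaryCircle_eq_transport h h₁ h₂ hD
  choose! E hEc hEb hEh using fun D (hD : D ∈ complComponents S₁) =>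
    exists_extension_component h h₁ h₂ hD (hσ D hD) (hσC D hD)
  have hσinj : InjOn σ (complComponents S₁) := by
    intro D hD D' hD' heq
    refine h₁.boundaryCircle_injOn hD hD' (transport_injOn h boundaryCircle_subset
      boundaryCircle_subset ?_)
    rw [hσC D hD, hσC D' hD', heq]
  let H : S2 → S2 := fun x =>
    if hx : x ∈ S₁ then h ⟨x, hx⟩ else E (connectedComponentIn S₁ᶜ x) x
  have hHS : ∀ x : S₁, H x = h x := fun x => dif_pos x.2
  have hHD : ∀ D ∈ complComponents S₁, ∀ x ∈ D, H x = E D x := fun D hD x hx => by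
    rw [eq_connectedComponentIn_of_mem hD hx]
    exact dif_neg (subset_compl_of_mem_complComponents hD hx)
  have hHcl : ∀ D ∈ complComponents S₁, EqOn H (E D) (closure D) := by
    intro D hD x hx
    by_cases hxS : x ∈ S₁
    · exact (hHS ⟨x, hxS⟩).trans (hEh D hD ⟨x, hxS⟩ hx).symm
    · refine hHD D hD x (by_contra fun hxD => hxS ?_)
      have : x ∈ boundaryCircle S₁ D := by rw [h₁.boundaryCircle_eq hD]; exact ⟨hx, hxD⟩
      exact this.2
  have hHσ : ∀ D ∈ complComponents S₁, ∀ x ∈ D, H x ∈ σ D := fun D hD x hx => by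
    rw [hHD D hD x hx]
    exact (hEb D hD).mapsTo hx
  have hHout : ∀ x, x ∉ S₁ → H x ∉ S₂ := fun x hx => by
    obtain ⟨D, hD, hxD⟩ := exists_mem_complComponents hx
    exact subset_compl_of_mem_complComponents (hσ D hD) (hHσ D hD x hxD)
  have hinj : Function.Injective H := by
    intro x y hxy
    by_cases hx : x ∈ S₁ <;> by_cases hy : y ∈ S₁
    · have := hHS ⟨x, hx⟩ ▸ hHS ⟨y, hy⟩ ▸ hxy
      exact Subtype.ext_iff.mp (h.injective (Subtype.ext this))
    · refine absurd ?_ (hHout y hy)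
      rw [← hxy, hHS ⟨x, hx⟩]
      exact (h _).2
    · refine absurd ?_ (hHout x hx)
      rw [hxy, hHS ⟨y, hy⟩]
      exact (h _).2
    · obtain ⟨D, hD, hxD⟩ := exists_mem_complComponents hx
      obtain ⟨D', hD', hyD'⟩ := exists_mem_complComponents hy
      have hDD' : D = D' := hσinj hD hD' (eq_of_mem_complComponents (hσ D hD) (hσ D' hD')
        (hHσ D hD x hxD) (hxy ▸ hHσ D' hD' y hyD'))
      subst hDD'
      refine (hEb D hD).injOn hxD hyD' ?_
      rw [← hHD D hD x hxD, ← hHD D hD y hyD', hxy]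
  have hsurj : Function.Surjective H := by
    intro y
    by_cases hy : y ∈ S₂
    · refine ⟨h.symm ⟨y, hy⟩, ?_⟩
      rw [hHS, h.apply_symm_apply]
    · obtain ⟨D', hD', hyD'⟩ := exists_mem_complComponents hy
      -- Applying the matching to `h.symm` shows that `σ` is onto.
      obtain ⟨D, hD, hDD'⟩ := exists_boundaryCircle_eq_transport h.symm h₂ h₁ hD'
      have hσD : σ D = D' := by
        refine h₂.boundaryCircle_injOn (hσ D hD) hD' ?_
        rw [← hσC D hD, ← hDD', transport_symm_transport h boundaryCircle_subset]
      subst hσD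
      obtain ⟨x, hx, hxy⟩ := (hEb D hD).surjOn hyD'
      exact ⟨x, (hHD D hD x hx).trans hxy⟩
  have hHc : ∀ D ∈ complComponents S₁, ContinuousOn H (closure D) := fun D hD =>
    (hEc D hD).congr (hHcl D hD)
  have hcont : Continuous H := by
    rw [continuous_iff_continuousAt]
    intro x
    by_cases hx : x ∈ S₁
    swap
    · obtain ⟨D, hD, hxD⟩ := exists_mem_complComponents hx
      exact (hHc D hD).continuousAt
        (Filter.mem_of_superset ((h₁.isOpen_component hD).mem_nhds hxD) subset_closure)
    have hHS₁ : ContinuousWithinAt H S₁ x := by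
      have : ContinuousOn H S₁ := by
        rw [continuousOn_iff_continuous_domRestrict]
        have h3 : S₁.domRestrict H = fun x => (h x : S2) := funext hHS
        rw [h3]
        fun_prop
      exact this x hx
    intro V hV
    obtain ⟨F', hF', W', hW', hFW'⟩ := h₂.exists_finite_nhds (H x) hV
    obtain ⟨W₀, hW₀W, hW₀o, hxW₀⟩ := mem_nhds_iff.mp hW'
    obtain ⟨V₁, hV₁, hV₁W⟩ := mem_nhdsWithin_iff_exists_mem_nhds_inter.mp
      (hHS₁ (hW₀o.mem_nhds hxW₀))
    obtain ⟨F, hF, W, hW, hFW⟩ := h₁.exists_finite_nhds x hV₁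
    -- The exceptional components, large in the source or in the target; they are finite in number
    -- because `σ` is injective. Each is handled by continuity of `H` on its closure.
    set G : Set (Set S2) := {D ∈ complComponents S₁ | D ∈ F ∨ σ D ∈ F'} with hG
    have hGfin : G.Finite := by
      have h3 : (complComponents S₁ ∩ σ ⁻¹' F').Finite :=
        Set.Finite.of_finite_image (hF'.subset (by rintro _ ⟨D, hD, rfl⟩; exact hD.2))
          (hσinj.mono inter_subset_left)
      refine (hF.union h3).subset ?_
      rintro D ⟨hD, h | h⟩
      · exact Or.inl h
      · exact Or.inr ⟨hD, h⟩
    have hGN : ∀ D ∈ G, ∀ᶠ y in 𝓝 x, y ∈ closure D → H y ∈ V := by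
      intro D hD
      by_cases hxD : x ∈ closure D
      · exact eventually_nhdsWithin_iff.mp (hHc D hD.1 x hxD hV)
      · filter_upwards [isClosed_closure.isOpen_compl.mem_nhds hxD] with y hy hy'
        exact absurd hy' hy
    have hVS : ∀ᶠ y in 𝓝 x, y ∈ S₁ → H y ∈ V := eventually_nhdsWithin_iff.mp (hHS₁ hV)
    have hGN' := (Filter.eventually_all_finite hGfin).mpr hGN
    change ∀ᶠ y in 𝓝 x, H y ∈ V
    filter_upwards [hVS, hGN', hW] with y hyS hyG hyW
    by_cases hy : y ∈ S₁
    · exact hyS hy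
    obtain ⟨D, hD, hyD⟩ := exists_mem_complComponents hy
    by_cases hDG : D ∈ G
    · exact hyG D hDG (subset_closure hyD)
    have hDF : D ∉ F := fun h => hDG ⟨hD, Or.inl h⟩
    have hDF' : σ D ∉ F' := fun h => hDG ⟨hD, Or.inr h⟩
    -- A point `c` of the circle links the two sides: it is close to `x`, so continuity of `h` puts
    -- `H c` near `H x`. Hence `σ D` comes near `H x` and, not being exceptional, lies in `V`.
    obtain ⟨c, hc⟩ := (h₁.boundaryCircle_nontrivial hD).nonempty
    have hcV := hFW D hD hDF ⟨y, hyD, hyW⟩ hc.1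
    have hHcW : H c ∈ W₀ := hV₁W ⟨hcV, hc.2⟩
    have hHcD : H c ∈ closure (σ D) := by
      have h3 : (h ⟨c, hc.2⟩ : S2) ∈ boundaryCircle S₂ (σ D) := by
        rw [← hσC D hD, coe_mem_transport]
        exact hc
      rw [hHS ⟨c, hc.2⟩]
      exact h3.1
    obtain ⟨z, hzW, hzD⟩ := mem_closure_iff.mp hHcD W₀ hW₀o hHcW
    exact hFW' (σ D) (hσ D hD) hDF' ⟨z, hzD, hW₀W hzW⟩ (subset_closure (hHσ D hD y hyD))
  exact ⟨(Equiv.ofBijective H ⟨hinj, hsurj⟩).toHomeomorphOfContinuousClosed hcont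
    hcont.isClosedMap, hHS⟩

end Transport

theorem mainTheorem10 :
    (∀ S : Set S2, IsTopologicalSchottkySet S →
      {C : Set S2 | IsEmbeddedCircleIn S C ∧ IsNonseparatingIn S C} =
        {C : Set S2 | ∃ D ∈ complComponents S, C = boundaryCircle S D}) ∧
    (∀ S₁ S₂ : Set S2, IsTopologicalSchottkySet S₁ → IsTopologicalSchottkySet S₂ →
      ∀ h : S₁ ≃ₜ S₂, ∃ H : S2 ≃ₜ S2, ∀ x : S₁, H (x : S2) = (h x : S2)) :=
  ⟨fun _ hS => hS.setOf_nonseparating_circles_eq,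
    fun _ _ h₁ h₂ h => exists_homeomorph_extension h h₁ h₂⟩
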